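/- Let $\mathcal H$ be a complex Hilbert space and let $S$ be a closed, densely defined symmetric operator in $\mathcal H$ with finite and equal deficiency indices $(n,n)$, that is, $\dim\ker(S^*-i)=\dim\ker(S^*+i)=n<\infty$. For a unit vector $\phi\in\mathrm{Dom}(S)$ put $\Delta S[\phi]:=\sqrt{\langle S\phi,S\phi\rangle-\langle S\phi,\phi\rangle^2}$. For $t\in\mathbb R$ let $\Delta S_t:=\inf\{\Delta S[\phi] : \phi\in\mathrm{Dom}(S),\ \|\phi\|=1,\ \langle S\phi,\phi\rangle=t\}$ (with $\inf\emptyset=+\infty$), and let $\Delta S:=\inf_{t\in\mathbb R}\Delta S_t$. Let $S'$ be any self-adjoint extension of $S$ in $\mathcal H$. 1. If $\Delta S>0$, then $S'$ has purely discrete spectrum: $\sigma(S')$ equals the set $\sigma_p(S')$ of eigenvalues of $S'$, every eigenvalue has finite multiplicity, and $\sigma(S')$ has no finite accumulation point. 2. Let $I\subset\mathbb R$ and $\varepsilon>0$ be such that $\Delta S_t>\varepsilon$ for all $t\in I$. Then $S'$ has at most $n$ eigenvalues, counted with multiplicity, in any interval $J\subset I$ of length at most $\varepsilon$. If moreover $n=1$,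 then $S'$ has at most one eigenvalue, counted with multiplicity, in any interval $J\subset I$ of length at most $2\varepsilon$. -/

import Mathlib

open scoped LinearPMap

namespace MinUncertainty

noncomputable section

variable {H : Type*} [NormedAddCommGroup H] [InnerProductSpace ℂ H]

/-- The operator `T - z`, on the domain of `T`. -/
def shift (T : H →ₗ.[ℂ] H) (z : ℂ) : T.domain →ₗ[ℂ] H :=
  T.toFun - z • T.domain.subtype

/-- The kernel of `T - z`, as a subspace of `H`. -/
def eigenspace (T : H →ₗ.[ℂ] H) (z : ℂ) : Submodule ℂ H :=
  (LinearMap.ker (shift T z)).map T.domain.subtype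

/-- `T - z` has a bounded inverse that is defined on all of `H`. -/
def InResolventSet (T : H →ₗ.[ℂ] H) (z : ℂ) : Prop :=
  ∃ R : H →L[ℂ] H, (∀ x : T.domain, R (shift T z x) = (x : H)) ∧
    ∀ y : H, ∃ h : R y ∈ T.domain, shift T z ⟨R y, h⟩ = y

/-- The spectrum `σ(T)`. -/
def spectrum (T : H →ₗ.[ℂ] H) : Set ℂ := {z | ¬ InResolventSet T z}

/-- The set `σ_p(T)` of all eigenvalues of `T`. -/
def pointSpectrum (T : H →ₗ.[ℂ] H) : Set ℂ := {z | eigenspace T z ≠ ⊥}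

/-- The spectrum consists of eigenvalues only, all of them of finite multiplicity, and it has no
finite accumulation point. -/
def HasPurelyDiscreteSpectrum (T : H →ₗ.[ℂ] H) : Prop :=
  spectrum T = pointSpectrum T ∧
    (∀ z ∈ spectrum T, FiniteDimensional ℂ (eigenspace T z)) ∧
    ∀ z : ℂ, ¬ AccPt z (Filter.principal (spectrum T))

/-- The number of eigenvalues of `T` in `J`, counted with multiplicity. A point of `J` that is not
an eigenvalue contributes `0`. -/
def eigenvalueCount (T : H →ₗ.[ℂ] H) (J : Set ℝ) : Cardinal :=
  Cardinal.sum fun μ : J => Module.rank ℂ (eigenspace T ((μ : ℝ) : ℂ))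

/-- `S` has deficiency indices `(n, n)`, with `n` finite: the spaces `ker (S* - i)` and
`ker (S* + i)` both have dimension `n`. -/
def HasDeficiencyIndices [CompleteSpace H] (S : H →ₗ.[ℂ] H) (n : ℕ) : Prop :=
  Module.rank ℂ (eigenspace S† Complex.I) = n ∧ Module.rank ℂ (eigenspace S† (-Complex.I)) = n

/-- The expectation value `⟨φ, S φ⟩`; this inner product is real when `S` is symmetric. -/
def expectation (S : H →ₗ.[ℂ] H) (φ : S.domain) : ℝ :=
  (inner ℂ (φ : H) (S φ)).re

/-- The uncertainty `ΔS[φ]` (for a unit vector `φ`, the radicand is nonnegative). -/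
def uncertainty (S : H →ₗ.[ℂ] H) (φ : S.domain) : ℝ :=
  Real.sqrt (‖S φ‖ ^ 2 - expectation S φ ^ 2)

/-- The minimum uncertainty `ΔS_t`. It is an extended real, so that the infimum over the empty set
is `+∞`. -/
def minUncertaintyAt (S : H →ₗ.[ℂ] H) (t : ℝ) : EReal :=
  ⨅ (φ : S.domain) (_ : ‖(φ : H)‖ = 1) (_ : expectation S φ = t), (uncertainty S φ : EReal)

/-- The overall lower bound `ΔS` on the uncertainty. -/
def minUncertainty (S : H →ₗ.[ℂ] H) : EReal := ⨅ t : ℝ, minUncertaintyAt S t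

end

end MinUncertainty

open MinUncertainty

/-! Dom `S` is small in codimension but rigid in uncertainty. Projecting `(S' + i)x` onto `ran(S +
i)ᗮ = ker(S* - i)` gives a map on Dom `S'` whose kernel lies in Dom `S` (`exists_linearMap_ker_le`).
If the eigenspaces of `S'` over `J` had total dimension above `n`, some nonzero sum of eigenvectors
would lie in Dom `S`. Normalised, it has its mean in `J` and uncertainty at most half the length of
`J` (`expectation_mem_and_uncertainty_le`), which contradicts the lower bound on `J`. This gives
`eigenvalueCount_le`.

For discreteness, `0 < δ < ΔS` makes every `S - r` with `r` real bounded below, so its range is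
closed. The range of `S' - r` is a finite-dimensional enlargement, hence closed too, so a real `r`
that is not an eigenvalue is in the resolvent set. Counting on intervals around a point gives finite
multiplicity and no accumulation. -/

namespace MinUncertainty

section

variable {H : Type*} [NormedAddCommGroup H] [InnerProductSpace ℂ H]

/-! ### Closed ranges, adjoints and the resolvent set -/

lemma shift_apply (T : H →ₗ.[ℂ] H) (z : ℂ) (x : T.domain) :
    shift T z x = T x - z • (x : H) := rfl

lemma mem_eigenspace {T : H →ₗ.[ℂ] H} {z : ℂ} {x : H} :
    x ∈ eigenspace T z ↔ ∃ h : x ∈ T.domain, T ⟨x, h⟩ = z • x := by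
  simp only [eigenspace, Submodule.mem_map, LinearMap.mem_ker, shift_apply, sub_eq_zero]
  constructor
  · rintro ⟨⟨y, hy⟩, h, rfl⟩
    exact ⟨hy, h⟩
  · rintro ⟨h, hx⟩
    exact ⟨⟨x, h⟩, hx, rfl⟩

lemma eigenspace_le_domain (T : H →ₗ.[ℂ] H) (z : ℂ) : eigenspace T z ≤ T.domain :=
  fun _ hx => (mem_eigenspace.1 hx).1

lemma ker_shift_eq_bot {T : H →ₗ.[ℂ] H} {z : ℂ} (h : eigenspace T z = ⊥) :
    LinearMap.ker (shift T z) = ⊥ := by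
  refine eq_bot_iff.2 fun x hx => ?_
  have : (x : H) ∈ eigenspace T z := ⟨x, hx, rfl⟩
  rw [h, Submodule.mem_bot] at this
  exact Subtype.ext this

lemma pointSpectrum_subset_spectrum (T : H →ₗ.[ℂ] H) : pointSpectrum T ⊆ spectrum T := by
  rintro z hz ⟨R, hR, -⟩
  refine hz (eq_bot_iff.2 fun x hx => ?_)
  obtain ⟨h, hx⟩ := mem_eigenspace.1 hx
  have := hR ⟨x, h⟩
  rw [shift_apply, hx] at this
  simpa using this.symm

lemma isClosed_setOf_shift_eq {T : H →ₗ.[ℂ] H} (hT : T.IsClosed) (z : ℂ) :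
    IsClosed {p : H × H | ∃ h : p.2 ∈ T.domain, shift T z ⟨p.2, h⟩ = p.1} := by
  have hc : Continuous fun p : H × H => (p.2, p.1 + z • p.2) := by fun_prop
  convert hT.preimage hc using 1
  ext ⟨y, x⟩
  simp only [Set.mem_ofPred_eq, Set.mem_preimage, SetLike.mem_coe, LinearPMap.mem_graph_iff,
    shift_apply]
  constructor
  · rintro ⟨h, h2⟩
    exact ⟨⟨x, h⟩, rfl, by simp [← h2]⟩
  · rintro ⟨⟨x', h⟩, rfl, h2⟩
    exact ⟨h, by simp [h2]⟩

lemma isClosed_range_shift [CompleteSpace H] {T : H →ₗ.[ℂ] H} (hT : T.IsClosed) {z : ℂ} {c : ℝ}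
    (hc : 0 < c) (h : ∀ x : T.domain, c * ‖(x : H)‖ ≤ ‖shift T z x‖) :
    IsClosed (LinearMap.range (shift T z) : Set H) := by
  refine IsSeqClosed.isClosed fun y y₀ hy hlim => ?_
  choose x hx using hy
  have hcau : CauchySeq fun k => (x k : H) := by
    rw [Metric.cauchySeq_iff]
    intro e he
    obtain ⟨N, hN⟩ := Metric.cauchySeq_iff.1 hlim.cauchySeq (c * e) (by positivity)
    refine ⟨N, fun m hm k hk => ?_⟩
    have h1 := hN m hm k hk
    have h2 := h (x m - x k)
    rw [map_sub, hx, hx] at h2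
    rw [dist_eq_norm] at h1 ⊢
    exact lt_of_mul_lt_mul_left (h2.trans_lt h1) hc.le
  obtain ⟨x₀, hx₀⟩ := cauchySeq_tendsto_of_complete hcau
  have := (isClosed_setOf_shift_eq hT z).mem_of_tendsto (hlim.prodMk_nhds hx₀)
    (Filter.Eventually.of_forall fun k => ⟨(x k).2, hx k⟩)
  obtain ⟨h1, h2⟩ := this
  exact ⟨⟨x₀, h1⟩, h2⟩

/-- Closed graph theorem: the algebraic inverse has a closed graph because `T` does. -/
lemma inResolventSet_of_bijective [CompleteSpace H] {T : H →ₗ.[ℂ] H} (hT : T.IsClosed) {z : ℂ}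
    (hinj : LinearMap.ker (shift T z) = ⊥) (hsurj : LinearMap.range (shift T z) = ⊤) :
    InResolventSet T z := by
  let e := LinearEquiv.ofBijective (shift T z)
    ⟨LinearMap.ker_eq_bot.1 hinj, LinearMap.range_eq_top.1 hsurj⟩
  let R : H →ₗ[ℂ] H := T.domain.subtype ∘ₗ e.symm.toLinearMap
  have he : ∀ y, shift T z (e.symm y) = y := fun y => e.apply_symm_apply y
  have hg : IsClosed (R.graph : Set (H × H)) := by
    convert isClosed_setOf_shift_eq hT z using 1
    ext ⟨y, x⟩
    simp only [SetLike.mem_coe, LinearMap.mem_graph_iff, Set.mem_ofPred_eq]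
    constructor
    · rintro rfl
      exact ⟨(e.symm y).2, he y⟩
    · rintro ⟨h, h2⟩
      rw [← h2]
      exact (congrArg Subtype.val (e.symm_apply_apply ⟨x, h⟩)).symm
  refine ⟨⟨R, R.continuous_of_isClosed_graph hg⟩, fun x => ?_, fun y => ⟨(e.symm y).2, he y⟩⟩
  exact congrArg Subtype.val (e.symm_apply_apply x)

lemma orthogonal_range_shift [CompleteSpace H] {T : H →ₗ.[ℂ] H}
    (hT : Dense (T.domain : Set H)) (z : ℂ) :
    (LinearMap.range (shift T z))ᗮ = eigenspace T† (starRingEnd ℂ z) := by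
  ext y
  rw [mem_eigenspace, Submodule.mem_orthogonal']
  constructor
  · intro hy
    have key : ∀ x : T.domain, inner ℂ (starRingEnd ℂ z • y) (x : H) = inner ℂ y (T x) := by
      intro x
      have := hy _ ⟨x, rfl⟩
      rw [shift_apply, inner_sub_right, sub_eq_zero, inner_smul_right] at this
      rw [this, inner_smul_left, Complex.conj_conj]
    have hd := LinearPMap.mem_adjoint_domain_of_exists y ⟨_, key⟩
    exact ⟨hd, LinearPMap.adjoint_apply_eq hT ⟨y, hd⟩ key⟩
  · rintro ⟨hd, hy⟩ _ ⟨x, rfl⟩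
    have := LinearPMap.adjoint_isFormalAdjoint hT ⟨y, hd⟩ x
    rw [hy, inner_smul_left, Complex.conj_conj] at this
    rw [shift_apply, inner_sub_right, inner_smul_right, ← this, sub_self]

/-- Since `⟨x, T x⟩` is real, `⟨x, (T - z)x⟩` has imaginary part `-(Im z)‖x‖²`; Cauchy–Schwarz does
the rest. -/
lemma abs_im_mul_norm_le {T : H →ₗ.[ℂ] H} (hT : T.IsFormalAdjoint T) (z : ℂ) (x : T.domain) :
    |z.im| * ‖(x : H)‖ ≤ ‖shift T z x‖ := by
  have h1 : (inner ℂ (x : H) (T x)).im = 0 := by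
    rw [← Complex.conj_eq_iff_im, inner_conj_symm, hT x x]
  have h2 : (inner ℂ (x : H) (shift T z x)).im = -(z.im * ‖(x : H)‖ ^ 2) := by
    rw [shift_apply, inner_sub_right, inner_smul_right, inner_self_eq_norm_sq_to_K]
    simp [h1, ← Complex.ofReal_pow]
  have h3 : |z.im| * ‖(x : H)‖ ^ 2 ≤ ‖(x : H)‖ * ‖shift T z x‖ := by
    have := (Complex.abs_im_le_norm _).trans (norm_inner_le_norm (𝕜 := ℂ) (x : H) (shift T z x))
    rwa [h2, abs_neg, abs_mul, abs_of_nonneg (sq_nonneg ‖(x : H)‖)] at this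
  rcases (norm_nonneg (x : H)).eq_or_lt with h0 | h0
  · rw [← h0, mul_zero]
    exact norm_nonneg _
  · refine le_of_mul_le_mul_left ?_ h0
    linarith

lemma eigenspace_eq_bot_of_im_ne_zero {T : H →ₗ.[ℂ] H} (hT : T.IsFormalAdjoint T) {z : ℂ}
    (hz : z.im ≠ 0) : eigenspace T z = ⊥ := by
  refine eq_bot_iff.2 fun x hx => ?_
  obtain ⟨h, hx⟩ := mem_eigenspace.1 hx
  have := abs_im_mul_norm_le hT z ⟨x, h⟩
  rw [shift_apply, hx, sub_self, norm_zero] at this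
  have h2 : 0 < |z.im| := abs_pos.2 hz
  have h3 : ‖x‖ ≤ 0 := by
    by_contra! h3
    exact absurd this (not_le.2 (mul_pos h2 h3))
  simpa using h3

lemma isFormalAdjoint_of_isSelfAdjoint [CompleteSpace H] {T : H →ₗ.[ℂ] H} (hT : IsSelfAdjoint T) :
    T.IsFormalAdjoint T := by
  have := LinearPMap.adjoint_isFormalAdjoint hT.dense_domain
  rwa [LinearPMap.isSelfAdjoint_def.1 hT] at this

/-- A self-adjoint operator with `T - z` of closed range has `z` in its resolvent set, unless `z`
or its conjugate is an eigenvalue. -/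
lemma inResolventSet_of_isClosed_range [CompleteSpace H] {T : H →ₗ.[ℂ] H} (hT : IsSelfAdjoint T)
    {z : ℂ} (hr : IsClosed (LinearMap.range (shift T z) : Set H)) (h1 : eigenspace T z = ⊥)
    (h2 : eigenspace T (starRingEnd ℂ z) = ⊥) : InResolventSet T z := by
  refine inResolventSet_of_bijective hT.isClosed (ker_shift_eq_bot h1) ?_
  have : CompleteSpace (LinearMap.range (shift T z)) := hr.completeSpace_coe
  rw [← Submodule.orthogonal_eq_bot_iff, orthogonal_range_shift hT.dense_domain,
    LinearPMap.isSelfAdjoint_def.1 hT, h2]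

lemma inResolventSet_of_im_ne_zero [CompleteSpace H] {T : H →ₗ.[ℂ] H} (hT : IsSelfAdjoint T)
    {z : ℂ} (hz : z.im ≠ 0) : InResolventSet T z := by
  have hs := isFormalAdjoint_of_isSelfAdjoint hT
  refine inResolventSet_of_isClosed_range hT
    (isClosed_range_shift hT.isClosed (abs_pos.2 hz) (abs_im_mul_norm_le hs z))
    (eigenspace_eq_bot_of_im_ne_zero hs hz) (eigenspace_eq_bot_of_im_ne_zero hs (by simpa using hz))

/-! ### Counting eigenvalues by deficiency index and uncertainty -/

/-- The domain of a self-adjoint extension exceeds that of `S` by at most the deficiency space. -/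
lemma exists_linearMap_ker_le [CompleteSpace H] {S S' : H →ₗ.[ℂ] H} (hclosed : S.IsClosed)
    (hdense : Dense (S.domain : Set H)) (hsymm : S.IsFormalAdjoint S) (hself : IsSelfAdjoint S')
    (hext : S ≤ S') :
    ∃ Φ : S'.domain →ₗ[ℂ] eigenspace S† Complex.I,
      ∀ x, Φ x = 0 → (x : H) ∈ S.domain := by
  have hr : IsClosed (LinearMap.range (shift S (-Complex.I)) : Set H) :=
    isClosed_range_shift hclosed (c := 1) one_pos fun x => by
      simpa using abs_im_mul_norm_le hsymm (-Complex.I) x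
  have horth : (LinearMap.range (shift S (-Complex.I)))ᗮ = eigenspace S† Complex.I := by
    rw [orthogonal_range_shift hdense]
    simp
  rw [← horth]
  generalize hK : LinearMap.range (shift S (-Complex.I)) = K at hr ⊢
  have hcompl : CompleteSpace K := hr.completeSpace_coe
  -- If `(S' + i)x` projects to zero, it equals `(S + i)y` for some `y` in Dom `S`, and injectivity
  -- of `S' + i` forces `x = y`.
  refine ⟨(Kᗮ.orthogonalProjectionOnto).toLinearMap ∘ₗ shift S' (-Complex.I), fun x hx => ?_⟩
  have hx' : shift S' (-Complex.I) x ∈ K := by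
    have h : shift S' (-Complex.I) x ∈ Kᗮᗮ :=
      Submodule.orthogonalProjectionOnto_eq_zero_iff.1 hx
    rwa [Submodule.orthogonal_orthogonal] at h
  rw [← hK] at hx'
  obtain ⟨y, hy⟩ := hx'
  have hyx : S y = S' ⟨y, hext.1 y.2⟩ := hext.2 rfl
  have hinj := ker_shift_eq_bot (eigenspace_eq_bot_of_im_ne_zero
    (isFormalAdjoint_of_isSelfAdjoint hself) (z := -Complex.I) (by simp))
  have : (⟨y, hext.1 y.2⟩ : S'.domain) = x := by
    refine LinearMap.ker_eq_bot.1 hinj ?_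
    rw [← hy, shift_apply, shift_apply, hyx]
  rw [← this]
  exact y.2

lemma orthogonalFamily_eigenspace {T : H →ₗ.[ℂ] H} (hT : T.IsFormalAdjoint T) (J : Set ℝ) :
    OrthogonalFamily ℂ (fun μ : J => eigenspace T ((μ : ℝ) : ℂ))
      fun μ => (eigenspace T ((μ : ℝ) : ℂ)).subtypeₗᵢ := by
  rintro μ ν hne ⟨x, hx⟩ ⟨y, hy⟩
  obtain ⟨hx, hx'⟩ := mem_eigenspace.1 hx
  obtain ⟨hy, hy'⟩ := mem_eigenspace.1 hy
  have := hT ⟨x, hx⟩ ⟨y, hy⟩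
  rw [hx', hy', inner_smul_left, inner_smul_right, Complex.conj_ofReal] at this
  have hne' : ((μ : ℝ) : ℂ) - ((ν : ℝ) : ℂ) ≠ 0 :=
    sub_ne_zero.2 fun h => hne (Subtype.ext (Complex.ofReal_injective h))
  have h0 : (((μ : ℝ) : ℂ) - ((ν : ℝ) : ℂ)) * inner ℂ x y = 0 := by
    simp only at this
    rw [sub_mul, this, sub_self]
  exact (mul_eq_zero.1 h0).resolve_left hne'

lemma minUncertaintyAt_le {S : H →ₗ.[ℂ] H} (φ : S.domain) (hφ : ‖(φ : H)‖ = 1) :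
    minUncertaintyAt S (expectation S φ) ≤ (uncertainty S φ : EReal) :=
  iInf_le_of_le φ (iInf_le_of_le hφ (iInf_le_of_le rfl le_rfl))

/-- A unit vector that is a sum of eigenvectors has its mean in the convex hull of the eigenvalues
and its uncertainty at most half the spread of the eigenvalues. -/
lemma expectation_mem_and_uncertainty_le {S S' : H →ₗ.[ℂ] H} (hext : S ≤ S')
    (hsymm : S'.IsFormalAdjoint S') {J : Set ℝ} (hJ : J.OrdConnected) {ε : ℝ} (hε : 0 < ε)
    (hdiam : Metric.ediam J ≤ ENNReal.ofReal (2 * ε)) (s : Finset J)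
    (v : ∀ μ : J, eigenspace S' ((μ : ℝ) : ℂ)) (x : S.domain)
    (hx : (x : H) = ∑ μ ∈ s, (v μ : H)) (hx1 : ‖(x : H)‖ = 1) :
    expectation S x ∈ J ∧ uncertainty S x ≤ ε := by
  have horth := orthogonalFamily_eigenspace hsymm J
  have hSx : S x = ∑ μ ∈ s, (((((μ : ℝ) : ℂ) • v μ :
      eigenspace S' ((μ : ℝ) : ℂ))) : H) := by
    have h1 : S x = S' ⟨x, hext.1 x.2⟩ := hext.2 rfl
    have h2 : (⟨x, hext.1 x.2⟩ : S'.domain) =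
        ∑ μ ∈ s, ⟨(v μ : H), eigenspace_le_domain _ _ (v μ).2⟩ := by
      apply Subtype.ext
      rw [hx, AddSubmonoidClass.coe_finsetSum]
    rw [h1, h2]
    change S'.toFun _ = _
    rw [map_sum]
    refine Finset.sum_congr rfl fun μ _ => ?_
    exact (mem_eigenspace.1 (v μ).2).2
  have hw : ∑ μ ∈ s, ‖v μ‖ ^ 2 = 1 := by
    have := horth.norm_sum v s
    simp only [Submodule.coe_subtypeₗᵢ, Submodule.subtype_apply, ← hx, hx1] at this
    rw [← this]; norm_num
  have hmean : expectation S x = ∑ μ ∈ s, ‖v μ‖ ^ 2 * (μ : ℝ) := by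
    have := horth.inner_sum v (fun μ => ((μ : ℝ) : ℂ) • v μ) s
    simp only [Submodule.coe_subtypeₗᵢ, Submodule.subtype_apply, ← hx, ← hSx] at this
    rw [expectation, this, Complex.re_sum]
    refine Finset.sum_congr rfl fun μ _ => ?_
    rw [inner_smul_right, inner_self_eq_norm_sq_to_K]
    simp [← Complex.ofReal_pow, mul_comm]
  have hsq : ‖S x‖ ^ 2 = ∑ μ ∈ s, ‖v μ‖ ^ 2 * (μ : ℝ) ^ 2 := by
    have := horth.norm_sum (fun μ => ((μ : ℝ) : ℂ) • v μ) s
    simp only [Submodule.coe_subtypeₗᵢ, Submodule.subtype_apply, ← hSx] at this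
    rw [this]
    refine Finset.sum_congr rfl fun μ _ => ?_
    rw [norm_smul, mul_pow, Complex.norm_real, Real.norm_eq_abs, sq_abs, mul_comm]
  refine ⟨?_, ?_⟩
  · rw [hmean]
    have := hJ.convex.sum_mem (t := s) (w := fun μ => ‖v μ‖ ^ 2) (z := fun μ => (μ : ℝ))
      (fun _ _ => sq_nonneg _) hw (fun μ _ => μ.2)
    simpa only [smul_eq_mul] using this
  · have hs : s.Nonempty := by
      rw [Finset.nonempty_iff_ne_empty]
      rintro rfl
      simp at hw
    obtain ⟨a, -, ha⟩ := s.exists_min_image (fun μ => (μ : ℝ)) hs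
    obtain ⟨b, -, hb⟩ := s.exists_max_image (fun μ => (μ : ℝ)) hs
    have hab : (b : ℝ) - a ≤ 2 * ε := by
      have h := (Metric.edist_le_ediam_of_mem b.2 a.2).trans hdiam
      rw [edist_dist, ENNReal.ofReal_le_ofReal_iff (by positivity), Real.dist_eq] at h
      exact (le_abs_self _).trans h
    -- Average `(μ - a)(μ - b) ≤ 0` with the weights `‖v μ‖²`. With mean `m` this bounds the
    -- variance by `(m - a)(b - m) ≤ ((b - a)/2)² ≤ ε²`.
    have hpop : ‖S x‖ ^ 2 - ((a : ℝ) + b) * expectation S x + a * b ≤ 0 := by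
      have : ‖S x‖ ^ 2 - ((a : ℝ) + b) * expectation S x + a * b =
          ∑ μ ∈ s, ‖v μ‖ ^ 2 * (((μ : ℝ) - a) * (μ - b)) := by
        have h1 : (a : ℝ) * b = a * b * ∑ μ ∈ s, ‖v μ‖ ^ 2 := by rw [hw, mul_one]
        rw [h1, hsq, hmean, Finset.mul_sum, Finset.mul_sum, ← Finset.sum_sub_distrib,
          ← Finset.sum_add_distrib]
        exact Finset.sum_congr rfl fun μ _ => by ring
      rw [this]
      refine Finset.sum_nonpos fun μ hμ => ?_
      exact mul_nonpos_of_nonneg_of_nonpos (sq_nonneg _)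
        (mul_nonpos_of_nonneg_of_nonpos (sub_nonneg.2 (ha μ hμ)) (sub_nonpos.2 (hb μ hμ)))
    have hba : (a : ℝ) ≤ b := by
      obtain ⟨μ, hμ⟩ := hs
      exact (ha μ hμ).trans (hb μ hμ)
    refine Real.sqrt_le_iff.2 ⟨hε.le, ?_⟩
    nlinarith [sq_nonneg (2 * expectation S x - a - b), mul_self_le_mul_self (sub_nonneg.2 hba) hab]

/-- The length `2 * ε` suffices for every `n`, so this covers both counting claims. -/
lemma eigenvalueCount_le [CompleteSpace H] {S S' : H →ₗ.[ℂ] H} (hclosed : S.IsClosed)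
    (hdense : Dense (S.domain : Set H)) (hsymm : S.IsFormalAdjoint S) (hself : IsSelfAdjoint S')
    (hext : S ≤ S') {n : ℕ} (hn : HasDeficiencyIndices S n) {J : Set ℝ} (hJ : J.OrdConnected)
    {ε : ℝ} (hε : 0 < ε) (hdiam : Metric.ediam J ≤ ENNReal.ofReal (2 * ε))
    (hmin : ∀ t ∈ J, (ε : EReal) < minUncertaintyAt S t) :
    eigenvalueCount S' J ≤ n := by
  classical
  obtain ⟨Φ, hΦ⟩ := exists_linearMap_ker_le hclosed hdense hsymm hself hext
  have hsymm' := isFormalAdjoint_of_isSelfAdjoint hself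
  have horth := orthogonalFamily_eigenspace hsymm' J
  let Ψ : (DirectSum J fun μ => eigenspace S' ((μ : ℝ) : ℂ)) →ₗ[ℂ] S'.domain :=
    DirectSum.toModule ℂ J S'.domain fun μ => Submodule.inclusion (eigenspace_le_domain S' _)
  have hΨ : ∀ l, ((Ψ l : S'.domain) : H) = ∑ μ ∈ l.support, (l μ : H) := by
    intro l
    conv_lhs => rw [← DirectSum.sum_support_of l]
    rw [map_sum, AddSubmonoidClass.coe_finsetSum]
    refine Finset.sum_congr rfl fun μ _ => ?_
    exact congrArg Subtype.val (DirectSum.toModule_lof (R := ℂ)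
      (φ := fun μ : J => Submodule.inclusion (eigenspace_le_domain S' ((μ : ℝ) : ℂ))) μ (l μ))
  -- A nonzero `l` in the kernel would give a nonzero vector of Dom `S` that is a sum of
  -- eigenvectors over `J`.
  have hinj : Function.Injective (Φ ∘ₗ Ψ) := by
    rw [← LinearMap.ker_eq_bot, eq_bot_iff]
    intro l hl
    have hdom : ((Ψ l : S'.domain) : H) ∈ S.domain := hΦ _ hl
    by_contra hl0
    have hne : ((Ψ l : S'.domain) : H) ≠ 0 := by
      intro h0
      have h1 := horth.norm_sum (fun μ => l μ) l.support
      simp only [Submodule.coe_subtypeₗᵢ, Submodule.subtype_apply, ← hΨ, h0, norm_zero] at h1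
      have h2 := (Finset.sum_eq_zero_iff_of_nonneg fun _ _ => sq_nonneg _).1
        (h1.symm.trans (by norm_num))
      apply hl0
      rw [Submodule.mem_bot]
      ext1 μ
      by_cases hμ : μ ∈ l.support
      · simpa using h2 μ hμ
      · simpa using hμ
    let c : ℂ := ((‖((Ψ l : S'.domain) : H)‖⁻¹ : ℝ) : ℂ)
    obtain ⟨h1, h2⟩ := expectation_mem_and_uncertainty_le hext hsymm' hJ hε hdiam l.support
      (fun μ => c • l μ) (c • ⟨_, hdom⟩) (by simp [hΨ, Finset.smul_sum])
      (by simp [c, norm_smul, hne])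
    refine (hmin _ h1).not_ge ((minUncertaintyAt_le _ ?_).trans (by exact_mod_cast h2))
    simp [c, norm_smul, hne]
  have := LinearMap.rank_le_of_injective _ hinj
  rw [hn.1, rank_directSum] at this
  exact this

lemma finite_of_eigenvalueCount_le {T : H →ₗ.[ℂ] H} {J : Set ℝ} {n : ℕ}
    (h : eigenvalueCount T J ≤ n) : {μ : J | eigenspace T ((μ : ℝ) : ℂ) ≠ ⊥}.Finite := by
  have hne : ∀ μ : {μ : J | eigenspace T ((μ : ℝ) : ℂ) ≠ ⊥},
      Nonempty (Module.rank ℂ (eigenspace T ((μ : ℝ) : ℂ))).out := fun μ => by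
    rw [← Cardinal.mk_ne_zero_iff, Cardinal.mk_out]
    exact fun h0 => μ.2 (Submodule.rank_eq_zero.1 h0)
  -- The cardinal sum is the size of a disjoint union to which each eigenvalue contributes a
  -- nonempty piece.
  have hfin : Finite (Σ μ : J, (Module.rank ℂ (eigenspace T ((μ : ℝ) : ℂ))).out) :=
    Cardinal.lt_aleph0_iff_finite.1 (h.trans_lt Cardinal.natCast_lt_aleph0)
  exact Set.finite_coe_iff.1 (Finite.of_injective
    (β := Σ μ : J, (Module.rank ℂ (eigenspace T ((μ : ℝ) : ℂ))).out)
    (fun μ => ⟨μ.1, (hne μ).some⟩) fun μ ν h => Subtype.ext (congrArg Sigma.fst h))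

/-! ### Discreteness of the spectrum -/

/-- For a unit vector with mean `m`, `‖(S - r)φ‖² = ΔS[φ]² + (m - r)²`, so `S - r` is bounded below
by `δ`. -/
lemma isClosed_range_shift_of_minUncertainty [CompleteSpace H] {S : H →ₗ.[ℂ] H}
    (hclosed : S.IsClosed) (hsymm : S.IsFormalAdjoint S) {δ : ℝ} (hδ : 0 < δ)
    (hmin : ∀ t, (δ : EReal) < minUncertaintyAt S t) (r : ℝ) :
    IsClosed (LinearMap.range (shift S r) : Set H) := by
  refine isClosed_range_shift hclosed hδ fun x => ?_
  have key : ∀ φ : S.domain, ‖(φ : H)‖ = 1 → δ ≤ ‖shift S r φ‖ := by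
    intro φ hφ
    have h1 : δ < uncertainty S φ := by
      exact_mod_cast (hmin _).trans_le (minUncertaintyAt_le φ hφ)
    have h2 : ‖shift S r φ‖ ^ 2 = ‖S φ‖ ^ 2 - 2 * r * expectation S φ + r ^ 2 := by
      have h3 : (inner ℂ (S φ) ((r : ℂ) • (φ : H))).re = r * expectation S φ := by
        rw [inner_smul_right, hsymm φ φ, Complex.re_ofReal_mul, expectation]
      have h4 := norm_sub_sq (𝕜 := ℂ) (S φ) ((r : ℂ) • (φ : H))
      rw [RCLike.re_eq_complex_re, h3, norm_smul, hφ, mul_one, Complex.norm_real,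
        Real.norm_eq_abs, sq_abs] at h4
      rw [shift_apply, h4]
      ring
    have h3 := (Real.lt_sqrt hδ.le).1 h1
    refine le_of_sq_le_sq ?_ (norm_nonneg _)
    nlinarith [sq_nonneg (expectation S φ - r)]
  rcases eq_or_ne (x : H) 0 with h0 | h0
  · rw [h0, norm_zero, mul_zero]
    exact norm_nonneg _
  · have hp : 0 < ‖(x : H)‖ := norm_pos_iff.2 h0
    have := key (((‖(x : H)‖⁻¹ : ℝ) : ℂ) • x) (by simp [norm_smul, h0])
    rw [map_smul, norm_smul, Complex.norm_real, norm_inv, norm_norm, inv_mul_eq_div,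
      le_div_iff₀ hp] at this
    exact this

lemma hasPurelyDiscreteSpectrum_of_minUncertainty [CompleteSpace H] {S S' : H →ₗ.[ℂ] H}
    (hclosed : S.IsClosed) (hdense : Dense (S.domain : Set H)) (hsymm : S.IsFormalAdjoint S)
    (hself : IsSelfAdjoint S') (hext : S ≤ S') {n : ℕ} (hn : HasDeficiencyIndices S n)
    {δ : ℝ} (hδ : 0 < δ) (hmin : ∀ t, (δ : EReal) < minUncertaintyAt S t) :
    HasPurelyDiscreteSpectrum S' := by
  have hreal : ∀ z ∈ spectrum S', ((z.re : ℝ) : ℂ) = z := by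
    intro z hz
    by_contra h
    exact hz (inResolventSet_of_im_ne_zero hself fun h0 => h (Complex.ext (by simp) (by simp [h0])))
  have hcount : ∀ r : ℝ, eigenvalueCount S' (Set.Icc (r - δ) (r + δ)) ≤ n := fun r =>
    eigenvalueCount_le hclosed hdense hsymm hself hext hn Set.ordConnected_Icc hδ
      (by rw [Real.ediam_Icc]; exact ENNReal.ofReal_le_ofReal (by linarith)) fun t _ => hmin t
  have hspec : spectrum S' = pointSpectrum S' := by
    refine Set.Subset.antisymm (fun z hz => ?_) (pointSpectrum_subset_spectrum S')
    intro h0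
    refine hz ?_
    rw [← hreal z hz] at h0 ⊢
    refine inResolventSet_of_isClosed_range hself ?_ h0 (by rwa [Complex.conj_ofReal])
    obtain ⟨Φ, hΦ⟩ := exists_linearMap_ker_le hclosed hdense hsymm hself hext
    have hfin : FiniteDimensional ℂ (eigenspace S† Complex.I) := by
      rw [FiniteDimensional, ← Module.rank_lt_aleph0_iff, hn.1]
      exact Cardinal.natCast_lt_aleph0
    let D : Submodule ℂ S'.domain := S.domain.comap S'.domain.subtype
    -- Dom `S` contains `ker Φ`, whose quotient embeds in the finite-dimensional deficiency space.
    have hD : D.CoFG := by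
      have hk : (LinearMap.ker Φ).CoFG := by
        exact Module.Finite.equiv Φ.quotKerEquivRange.symm
      exact hk.of_le fun x hx => hΦ x hx
    refine LinearMap.isClosed_range_of_isClosed_map_of_finiteDimensional_quotient (s := D) ?_
    convert isClosed_range_shift_of_minUncertainty hclosed hsymm hδ hmin z.re using 1
    ext y
    constructor
    · rintro ⟨x, hx, rfl⟩
      refine ⟨⟨x, hx⟩, ?_⟩
      rw [shift_apply, shift_apply, hext.2 (x := ⟨x, hx⟩) (y := x) rfl]
    · rintro ⟨x, rfl⟩
      refine ⟨⟨x, hext.1 x.2⟩, x.2, ?_⟩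
      rw [shift_apply, shift_apply, hext.2 (x := x) (y := ⟨x, hext.1 x.2⟩) rfl]
  refine ⟨hspec, fun z hz => ?_, fun z hz => ?_⟩
  · rw [FiniteDimensional, ← Module.rank_lt_aleph0_iff, ← hreal z hz]
    refine lt_of_le_of_lt ?_ (Cardinal.natCast_lt_aleph0 (n := n))
    refine le_trans ?_ (hcount z.re)
    exact Cardinal.le_sum (fun μ : Set.Icc (z.re - δ) (z.re + δ) =>
      Module.rank ℂ (eigenspace S' ((μ : ℝ) : ℂ))) ⟨z.re, by constructor <;> linarith⟩
  · have hU : Complex.re ⁻¹' Set.Icc (z.re - δ) (z.re + δ) ∈ nhds z :=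
      Complex.continuous_re.continuousAt.preimage_mem_nhds
        (Icc_mem_nhds (by linarith) (by linarith))
    have hinf := Set.Infinite.of_accPt (hz.nhds_inter hU)
    refine hinf ?_
    refine ((finite_of_eigenvalueCount_le (hcount z.re)).image
      fun μ : Set.Icc (z.re - δ) (z.re + δ) => ((μ : ℝ) : ℂ)).subset ?_
    rintro w ⟨hw1, hw2⟩
    refine ⟨⟨w.re, hw1⟩, ?_, hreal w hw2⟩
    have h := hspec ▸ hw2
    rw [← hreal w hw2] at h
    exact h

end

end MinUncertainty

theorem theorem2 {H : Type*} [NormedAddCommGroup H] [InnerProductSpace ℂ H] [CompleteSpace H]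
    (S : H →ₗ.[ℂ] H) (hclosed : S.IsClosed) (hdense : Dense (S.domain : Set H))
    (hsymm : S.IsFormalAdjoint S) (n : ℕ) (hn : HasDeficiencyIndices S n)
    (S' : H →ₗ.[ℂ] H) (hself : IsSelfAdjoint S') (hext : S ≤ S') :
    (0 < minUncertainty S → HasPurelyDiscreteSpectrum S') ∧
    ∀ (I : Set ℝ) (ε : ℝ), 0 < ε → (∀ t ∈ I, (ε : EReal) < minUncertaintyAt S t) →
      (∀ J : Set ℝ, J ⊆ I → J.OrdConnected → Metric.ediam J ≤ ENNReal.ofReal ε →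
        eigenvalueCount S' J ≤ n) ∧
      (n = 1 → ∀ J : Set ℝ, J ⊆ I → J.OrdConnected →
        Metric.ediam J ≤ ENNReal.ofReal (2 * ε) → eigenvalueCount S' J ≤ 1) := by
  refine ⟨fun h => ?_, fun I ε hε hI => ⟨fun J hJI hJ hdiam => ?_, fun h1 J hJI hJ hdiam => ?_⟩⟩
  · obtain ⟨δ, h0, hδ⟩ := EReal.lt_iff_exists_real_btwn.1 h
    exact hasPurelyDiscreteSpectrum_of_minUncertainty hclosed hdense hsymm hself hext hn
      (EReal.coe_pos.1 h0) fun t => hδ.trans_le (iInf_le _ t)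
  · exact eigenvalueCount_le hclosed hdense hsymm hself hext hn hJ hε
      (hdiam.trans (ENNReal.ofReal_le_ofReal (by linarith))) fun t ht => hI t (hJI ht)
  · have := eigenvalueCount_le hclosed hdense hsymm hself hext hn hJ hε hdiam
      fun t ht => hI t (hJI ht)
    rwa [h1, Nat.cast_one] at this
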